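/- Let $X$ be a real random variable and $Y$ a random variable with values in an arbitrary measurable space $\mathcal{Y}$, defined on a common probability space, and let $\Delta>0$. All logarithms are natural. Let $$R_{X|Y}(\Delta):=\inf_{\hat X:\ \mathbb{E}[(X-\hat X)^2]\le\Delta} I(X;\hat X\,|\,Y)$$ be the conditional rate-distortion function under mean-squared error, the infimum being over all real random variables $\hat X$ jointly distributed with $(X,Y)$ (that is, over all laws of triples $(X,Y,\hat X)$ with the given law of $(X,Y)$), where $I(X;\hat X|Y)\in[0,\infty]$ is the conditional mutual information, i.e. the Kullback-Leibler divergence of the law of $(Y,X,\hat X)$ from $P_Y\otimes(P_{X|Y}\times P_{\hat X|Y})$. Let $N(X|Y):=\frac{1}{2\pi e}e^{2h(X|Y)}\in[0,\infty]$ be the conditional entropy power, where $h(X|Y)=\mathbb{E}[-\log f_{X|Y}(X|Y)]$ is the conditional differential entropy, with $h(X|Y)=-\infty$ (so $N(X|Y)=0$) if $X$ has no conditional density given $Y$ or if this expectation is of the form $\infty-\infty$. Let $\mathbb{E}[\mathrm{Var}(X|Y)]\in[0,\infty]$ be the mean, over $y\sim P_Y$, of the variance of the conditional law of $X$ given $Y=y$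 (a law without finite second moment having variance $\infty$). Then, with $\log^+ t:=\max(\log t,0)$, $\log^+0=0$ and $\log^+\infty=\infty$, $$\frac12\log^+\frac{N(X|Y)}{\Delta}\ \le\ R_{X|Y}(\Delta)\ \le\ \frac12\log^+\frac{\mathbb{E}[\mathrm{Var}(X|Y)]}{\Delta}.$$ -/

import Mathlib

open MeasureTheory ProbabilityTheory
open scoped ENNReal

noncomputable section

namespace CondRD

/-- Positive part of the natural logarithm, `log⁺ x = max (log x) 0`, on `[0, ∞]`
(so `log⁺ 0 = 0` and `log⁺ ∞ = ∞`). -/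
def logPos (x : ℝ≥0∞) : ℝ≥0∞ := (ENNReal.log x).toENNReal

section

variable {Ω 𝒴 α β : Type*} [MeasurableSpace Ω] [MeasurableSpace 𝒴]
  [MeasurableSpace α] [StandardBorelSpace α] [Nonempty α]
  [MeasurableSpace β] [StandardBorelSpace β] [Nonempty β]

/-- Conditional mutual information `I(U; V | Y)` in nats: the Kullback-Leibler divergence of the
joint law of `(Y, (U, V))` from the law `P_Y ⊗ (P_{U|Y} × P_{V|Y})` that makes `U` and `V`
conditionally independent given `Y`. -/
def condMutualInfo (U : Ω → α) (V : Ω → β) (Y : Ω → 𝒴) (μ : Measure Ω) [IsFiniteMeasure μ] :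
    ℝ≥0∞ :=
  InformationTheory.klDiv (μ.map (fun ω => (Y ω, (U ω, V ω))))
    ((μ.map Y).compProd ((condDistrib U Y μ).prod (condDistrib V Y μ)))

/-- Conditional density `f_{X|Y}(x | y)` of the real random variable `X` given `Y`: the density of
the law of `(Y, X)` with respect to `P_Y ⊗ Lebesgue`. -/
def condDensity (X : Ω → ℝ) (Y : Ω → 𝒴) (μ : Measure Ω) (p : 𝒴 × ℝ) : ℝ :=
  ((μ.map (fun ω => (Y ω, X ω))).rnDeriv ((μ.map Y).prod volume) p).toReal

open scoped Classical in
/-- Conditional differential entropy `h(X | Y) = E[-log f_{X|Y}(X | Y)]` in nats, as an extended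
real number: the expectation of the positive part minus the expectation of the negative part.
It is `-∞` if `X` has no conditional density given `Y`, and also in the indeterminate case
`∞ - ∞`. -/
def condDiffEntropy (X : Ω → ℝ) (Y : Ω → 𝒴) (μ : Measure Ω) : EReal :=
  if μ.map (fun ω => (Y ω, X ω)) ≪ (μ.map Y).prod volume then
    ((∫⁻ ω, ENNReal.ofReal (-Real.log (condDensity X Y μ (Y ω, X ω))) ∂μ : ℝ≥0∞) : EReal)
      - ((∫⁻ ω, ENNReal.ofReal (Real.log (condDensity X Y μ (Y ω, X ω))) ∂μ : ℝ≥0∞) : EReal)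
  else ⊥

/-- Conditional entropy power `N(X | Y) = e^{2 h(X | Y)} / (2 π e)`, in `[0, ∞]`. -/
def condEntropyPower (X : Ω → ℝ) (Y : Ω → 𝒴) (μ : Measure Ω) : ℝ≥0∞ :=
  ENNReal.ofReal (1 / (2 * Real.pi * Real.exp 1)) * EReal.exp (2 * condDiffEntropy X Y μ)

/-- Mean conditional variance `E[Var(X | Y)]`, in `[0, ∞]`: the average over `y ∼ P_Y` of the
variance of the conditional law of `X` given `Y = y`. The extended variance is `∞` for a law
without a finite second moment. -/
def meanCondVar (X : Ω → ℝ) (Y : Ω → 𝒴) (μ : Measure Ω) [IsFiniteMeasure μ] : ℝ≥0∞ :=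
  ∫⁻ y, evariance (fun x : ℝ => x) (condDistrib X Y μ y) ∂(μ.map Y)

/-- Conditional rate-distortion function `R_{X|Y}(Δ)` under mean-squared error: the infimum of
`I(X; X̂ | Y)` over all `X̂` jointly distributed with `(X, Y)` such that `E[(X - X̂)²] ≤ Δ`.
The joint distribution ranges over all laws `Q` of triples `((x, y), x̂)` whose first marginal
is the law of `(X, Y)`. -/
def condRateDistortion (X : Ω → ℝ) (Y : Ω → 𝒴) (μ : Measure Ω) (Δ : ℝ) : ℝ≥0∞ :=
  ⨅ (Q : ProbabilityMeasure ((ℝ × 𝒴) × ℝ))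
    (_ : (Q : Measure ((ℝ × 𝒴) × ℝ)).map Prod.fst = μ.map (fun ω => (X ω, Y ω)))
    (_ : ∫⁻ p, ENNReal.ofReal ((p.1.1 - p.2) ^ 2) ∂(Q : Measure ((ℝ × 𝒴) × ℝ))
      ≤ ENNReal.ofReal Δ),
    condMutualInfo (fun p : (ℝ × 𝒴) × ℝ => p.1.1) (fun p => p.2) (fun p => p.1.2)
      (Q : Measure ((ℝ × 𝒴) × ℝ))

end

end CondRD

end

/-! Upper bound. Let `m(Y)` be the conditional mean and `W = E[Var(X|Y)]`; the case `W = ∞` is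
trivial. If `W ≤ Δ`, then `X̂ = m(Y)` costs no information. Otherwise take `X̂ = m(Y) + a (X - m(Y))
+ N(0, Δa)` with `a = 1 - Δ/W`, whose distortion is exactly `Δ`. By `condMutualInfo_le_klDiv`, the
unknown law of `X̂` given `Y` may be replaced by the Gaussian `N(m(Y), Wa)`, and
`klDiv_gaussianChannel` then gives `½ log (W/Δ)`.

Lower bound. Let `L` be the density of the joint law against `P_Y ⊗ (P_{X|Y} × P_{X̂|Y})`, and let
`D` be the `N(x̂, Δ)` density at `x` divided by `f_{X|Y}(x|y)`. Since `D` has integral at most 1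
against the product law (`lintegral_div_condDensity_le`), `E[D/L] ≤ 1`, and `log t ≤ t - 1` gives `E
log D ≤ E log L = I`. The distortion constraint gives `E log D ≥ h(X|Y) - ½ log (2πeΔ)`. This Gibbs
argument never mentions `h(X|Y,X̂)`, and it shows that `h(X|Y)` is finite in the nontrivial case. -/

open InformationTheory
open scoped NNReal

noncomputable section

namespace CondRD

/-! ### Gaussian channels -/

section Gaussian

variable {Z : Type*} [MeasurableSpace Z]

/-- The Markov kernel `z ↦ N(f z, v)`. -/
def gaussianChannel (f : Z → ℝ) (hf : Measurable f) (v : ℝ≥0) : Kernel Z ℝ where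
  toFun z := gaussianReal (f z) v
  measurable' := measurable_gaussianReal.comp (hf.prodMk measurable_const)

lemma gaussianChannel_apply (f : Z → ℝ) (hf : Measurable f) (v : ℝ≥0) (z : Z) :
    gaussianChannel f hf v z = gaussianReal (f z) v := rfl

instance (f : Z → ℝ) (hf : Measurable f) (v : ℝ≥0) : IsMarkovKernel (gaussianChannel f hf v) :=
  ⟨fun z => by rw [gaussianChannel_apply]; infer_instance⟩

variable (ρ : Measure Z) [IsProbabilityMeasure ρ]

/-- A Gaussian channel adds independent centred noise to its mean. Zero variance is allowed, which
the zero-rate case needs. -/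
lemma compProd_gaussianChannel_eq_map {f : Z → ℝ} (hf : Measurable f) (v : ℝ≥0) :
    ρ ⊗ₘ gaussianChannel f hf v
      = (ρ.prod (gaussianReal 0 v)).map (fun p => (p.1, f p.1 + p.2)) := by
  refine Measure.ext_of_lintegral _ fun g hg => ?_
  rw [Measure.lintegral_compProd hg, lintegral_map hg (by fun_prop),
    lintegral_prod _ (by fun_prop)]
  refine lintegral_congr fun z => ?_
  have h : gaussianReal (f z) v = (gaussianReal 0 v).map (f z + ·) := by
    rw [gaussianReal_map_const_add, zero_add]
  rw [gaussianChannel_apply, h, lintegral_map (by fun_prop) (by fun_prop)]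

lemma compProd_gaussianChannel_eq_withDensity {f : Z → ℝ} (hf : Measurable f) {v : ℝ≥0}
    (hv : v ≠ 0) :
    ρ ⊗ₘ gaussianChannel f hf v
      = (ρ.prod volume).withDensity (fun p => gaussianPDF (f p.1) v p.2) := by
  have hm : Measurable (fun p : Z × ℝ => gaussianPDF (f p.1) v p.2) :=
    measurable_uncurry_gaussianPDF.comp (by fun_prop : Measurable fun p : Z × ℝ => (f p.1, v, p.2))
  refine Measure.ext_of_lintegral _ fun g hg => ?_
  rw [Measure.lintegral_compProd hg, lintegral_withDensity_eq_lintegral_mul _ hm hg,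
    lintegral_prod _ (by fun_prop)]
  refine lintegral_congr fun z => ?_
  rw [gaussianChannel_apply, gaussianReal_of_var_ne_zero _ hv,
    lintegral_withDensity_eq_lintegral_mul _ (measurable_gaussianPDF _ _) (by fun_prop)]
  rfl

lemma integrable_sq_gaussianReal (v : ℝ≥0) : Integrable (fun x => x ^ 2) (gaussianReal 0 v) :=
  (memLp_id_gaussianReal 2).integrable_sq

lemma integrable_id_gaussianReal (v : ℝ≥0) : Integrable (fun x => x) (gaussianReal 0 v) :=
  (memLp_id_gaussianReal 1).integrable le_rfl

lemma integral_sq_gaussianReal (v : ℝ≥0) : ∫ x, x ^ 2 ∂(gaussianReal 0 v) = v := by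
  have h := variance_eq_integral (μ := gaussianReal 0 v) (X := fun x => x) (by fun_prop)
  rw [variance_fun_id_gaussianReal, integral_id_gaussianReal] at h
  simpa using h.symm

lemma integral_sq_gaussian_noise {u : Z → ℝ} (hu : Measurable u)
    (hu2 : Integrable (fun z => u z ^ 2) ρ) (v : ℝ≥0) :
    Integrable (fun p : Z × ℝ => (u p.1 + p.2) ^ 2) (ρ.prod (gaussianReal 0 v)) ∧
      ∫ p : Z × ℝ, (u p.1 + p.2) ^ 2 ∂(ρ.prod (gaussianReal 0 v)) = ∫ z, u z ^ 2 ∂ρ + v := by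
  have hu1 : Integrable u ρ :=
    ((memLp_two_iff_integrable_sq hu.aestronglyMeasurable).2 hu2).integrable (by norm_num)
  have i1 : Integrable (fun p : Z × ℝ => u p.1 ^ 2) (ρ.prod (gaussianReal 0 v)) :=
    hu2.comp_fst _
  have i2 : Integrable (fun p : Z × ℝ => u p.1 * p.2) (ρ.prod (gaussianReal 0 v)) :=
    hu1.mul_prod (integrable_id_gaussianReal v)
  have i3 : Integrable (fun p : Z × ℝ => p.2 ^ 2) (ρ.prod (gaussianReal 0 v)) :=
    (integrable_sq_gaussianReal v).comp_snd _
  have he : (fun p : Z × ℝ => (u p.1 + p.2) ^ 2)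
      = fun p => u p.1 ^ 2 + 2 * (u p.1 * p.2) + p.2 ^ 2 := by
    ext p; ring
  rw [he]
  have i12 : Integrable (fun p : Z × ℝ => u p.1 ^ 2 + 2 * (u p.1 * p.2))
      (ρ.prod (gaussianReal 0 v)) := i1.add (i2.const_mul 2)
  refine ⟨i12.add i3, ?_⟩
  rw [integral_add i12 i3, integral_add i1 (i2.const_mul 2), integral_const_mul,
    integral_prod_mul (μ := ρ) (ν := gaussianReal 0 v) u (fun x => x), integral_id_gaussianReal]
  have e1 : ∫ p : Z × ℝ, u p.1 ^ 2 ∂(ρ.prod (gaussianReal 0 v)) = ∫ z, u z ^ 2 ∂ρ := by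
    rw [integral_fun_fst (fun z => u z ^ 2)]; simp
  have e2 : ∫ p : Z × ℝ, p.2 ^ 2 ∂(ρ.prod (gaussianReal 0 v)) = v := by
    rw [integral_fun_snd (fun x : ℝ => x ^ 2)]; simp [integral_sq_gaussianReal]
  rw [e1, e2]; ring

/-- The log-likelihood ratio of two measures given by densities with respect to a common one. -/
lemma llr_withDensity {α : Type*} [MeasurableSpace α] (ν : Measure α) {p q : α → ℝ≥0∞}
    (hp : Measurable p) (hq : Measurable q) (hq0 : ∀ x, q x ≠ 0) (hqt : ∀ x, q x ≠ ∞)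
    [SigmaFinite (ν.withDensity q)] :
    ν.withDensity p ≪ ν.withDensity q ∧
      llr (ν.withDensity p) (ν.withDensity q)
        =ᵐ[ν.withDensity p] fun x => Real.log (p x / q x).toReal := by
  have h : ν.withDensity p = (ν.withDensity q).withDensity (fun x => p x / q x) := by
    rw [← withDensity_mul _ hq (by fun_prop)]
    congr 1
    ext x
    simp [ENNReal.mul_div_cancel (hq0 x) (hqt x)]
  have hac : ν.withDensity p ≪ ν.withDensity q := by
    rw [h]; exact withDensity_absolutelyContinuous _ _
  refine ⟨hac, ?_⟩
  have := hac.ae_le (Measure.rnDeriv_withDensity (ν.withDensity q)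
    (f := fun x => p x / q x) (by fun_prop))
  rw [← h] at this
  filter_upwards [this] with x hx
  rw [llr, hx]

lemma log_gaussianPDF (m : ℝ) {v : ℝ≥0} (hv : v ≠ 0) (x : ℝ) :
    Real.log (gaussianPDF m v x).toReal
      = -(Real.log (2 * Real.pi * v) / 2) - (x - m) ^ 2 / (2 * v) := by
  have hv' : (0 : ℝ) < v := by positivity
  rw [toReal_gaussianPDF, gaussianPDFReal, Real.log_mul (by positivity) (by positivity),
    Real.log_exp, Real.log_inv, Real.log_sqrt (by positivity)]
  ring

/-- The conditional relative entropy of two Gaussian channels. -/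
lemma klDiv_gaussianChannel {f g : Z → ℝ} (hf : Measurable f) (hg : Measurable g)
    {v s : ℝ≥0} (hv : v ≠ 0) (hs : s ≠ 0) (hfg : Integrable (fun z => (f z - g z) ^ 2) ρ) :
    klDiv (ρ ⊗ₘ gaussianChannel f hf v) (ρ ⊗ₘ gaussianChannel g hg s)
      = ENNReal.ofReal (Real.log (s / v) / 2 - 1 / 2
          + (∫ z, (f z - g z) ^ 2 ∂ρ + v) / (2 * s)) := by
  have hv' : (0 : ℝ) < v := by positivity
  have hs' : (0 : ℝ) < s := by positivity
  have hm : ∀ (f : Z → ℝ), Measurable f → ∀ v : ℝ≥0,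
      Measurable (fun p : Z × ℝ => gaussianPDF (f p.1) v p.2) := fun f hf v =>
    measurable_uncurry_gaussianPDF.comp (by fun_prop : Measurable fun p : Z × ℝ => (f p.1, v, p.2))
  obtain ⟨hac, hllr⟩ : ρ ⊗ₘ gaussianChannel f hf v ≪ ρ ⊗ₘ gaussianChannel g hg s ∧
      llr (ρ ⊗ₘ gaussianChannel f hf v) (ρ ⊗ₘ gaussianChannel g hg s)
        =ᵐ[ρ ⊗ₘ gaussianChannel f hf v] fun p =>
          Real.log (gaussianPDF (f p.1) v p.2 / gaussianPDF (g p.1) s p.2).toReal := by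
    have hsf : SigmaFinite ((ρ.prod volume).withDensity
        (fun p : Z × ℝ => gaussianPDF (g p.1) s p.2)) := by
      rw [← compProd_gaussianChannel_eq_withDensity ρ hg hs]; infer_instance
    rw [compProd_gaussianChannel_eq_withDensity ρ hf hv,
      compProd_gaussianChannel_eq_withDensity ρ hg hs]
    exact llr_withDensity (ρ.prod volume) (hm f hf v) (hm g hg s)
      (fun p => (gaussianPDF_pos _ hs _).ne') (fun p => gaussianPDF_ne_top)
  set F : Z × ℝ → ℝ := fun p => Real.log (s / v) / 2 + (p.2 - g p.1) ^ 2 / (2 * s)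
    - (p.2 - f p.1) ^ 2 / (2 * v) with hF
  have hFm : Measurable F := by fun_prop
  have hllr' : llr (ρ ⊗ₘ gaussianChannel f hf v) (ρ ⊗ₘ gaussianChannel g hg s)
        =ᵐ[ρ ⊗ₘ gaussianChannel f hf v] F := by
    filter_upwards [hllr] with p hp
    have h1 : (gaussianPDF (f p.1) v p.2).toReal ≠ 0 := by
      rw [toReal_gaussianPDF]; exact (gaussianPDFReal_pos _ _ _ hv).ne'
    have h2 : (gaussianPDF (g p.1) s p.2).toReal ≠ 0 := by
      rw [toReal_gaussianPDF]; exact (gaussianPDFReal_pos _ _ _ hs).ne'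
    rw [hp, ENNReal.toReal_div, Real.log_div h1 h2, log_gaussianPDF _ hv, log_gaussianPDF _ hs, hF,
      Real.log_mul (y := (v : ℝ)) (by positivity) (by positivity),
      Real.log_mul (y := (s : ℝ)) (by positivity) (by positivity),
      Real.log_div (by positivity) (by positivity)]
    ring
  obtain ⟨i1, e1⟩ := integral_sq_gaussian_noise ρ (hf.sub hg) hfg v
  have i2 : Integrable (fun p : Z × ℝ => p.2 ^ 2) (ρ.prod (gaussianReal 0 v)) :=
    (integrable_sq_gaussianReal v).comp_snd _
  have e2 : ∫ p : Z × ℝ, p.2 ^ 2 ∂(ρ.prod (gaussianReal 0 v)) = v := by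
    rw [integral_fun_snd (fun x : ℝ => x ^ 2)]; simp [integral_sq_gaussianReal]
  -- In noise coordinates `p.2 - f p.1` is the noise alone and `p.2 - g p.1` is `f - g` plus noise,
  -- so only second moments remain.
  have hcomp : (fun p : Z × ℝ => F (p.1, f p.1 + p.2)) = fun p => Real.log (s / v) / 2
      + ((f - g) p.1 + p.2) ^ 2 / (2 * s) - p.2 ^ 2 / (2 * v) := by
    ext p; simp only [hF, Pi.sub_apply]; ring
  have i3 : Integrable (fun p : Z × ℝ => Real.log (s / v) / 2
      + ((f - g) p.1 + p.2) ^ 2 / (2 * s)) (ρ.prod (gaussianReal 0 v)) :=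
    (integrable_const _).add (i1.div_const (2 * s))
  have hint : Integrable F (ρ ⊗ₘ gaussianChannel f hf v) := by
    rw [compProd_gaussianChannel_eq_map, integrable_map_measure hFm.aestronglyMeasurable
      (by fun_prop)]
    change Integrable (fun p : Z × ℝ => F (p.1, f p.1 + p.2)) _
    rw [hcomp]
    exact i3.sub (i2.div_const _)
  have hval : ∫ p, F p ∂(ρ ⊗ₘ gaussianChannel f hf v) = Real.log (s / v) / 2 - 1 / 2
          + (∫ z, (f z - g z) ^ 2 ∂ρ + v) / (2 * s) := by
    rw [compProd_gaussianChannel_eq_map, integral_map (by fun_prop) hFm.aestronglyMeasurable,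
      hcomp, integral_sub i3 (i2.div_const _), integral_add (integrable_const _)
      (i1.div_const (2 * s)), integral_div, integral_div, integral_div, e1, e2]
    simp only [integral_const, probReal_univ, Pi.sub_apply, one_smul]
    field_simp
    ring
  rw [klDiv_of_ac_of_integrable hac ((integrable_congr hllr').2 hint),
    integral_congr_ae hllr', hval]
  simp

end Gaussian

/-! ### The golden formula inequality -/

section Golden

lemma lintegral_compProd_prodMkRight {𝒴 α β : Type*} [MeasurableSpace 𝒴] [MeasurableSpace α]
    [MeasurableSpace β] (ν : Measure 𝒴) [SFinite ν] (κ : Kernel 𝒴 α) [IsSFiniteKernel κ]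
    (η : Kernel 𝒴 β) [IsSFiniteKernel η] {g : (𝒴 × α) × β → ℝ≥0∞} (hg : Measurable g) :
    ∫⁻ p, g p ∂((ν ⊗ₘ κ) ⊗ₘ η.prodMkRight α)
      = ∫⁻ y, ∫⁻ a, ∫⁻ b, g ((y, a), b) ∂(η y) ∂(κ y) ∂ν := by
  rw [Measure.lintegral_compProd hg, Measure.lintegral_compProd
    (f := fun q : 𝒴 × α => ∫⁻ b, g (q, b) ∂(η.prodMkRight α q))
    (Measurable.lintegral_kernel_prod_right' hg)]
  rfl

variable {Ω 𝒴 α β : Type*} [MeasurableSpace Ω] [MeasurableSpace 𝒴]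
  [MeasurableSpace α] [StandardBorelSpace α] [Nonempty α]
  [MeasurableSpace β] [StandardBorelSpace β] [Nonempty β]

/-- The conditional mutual information is at most the conditional relative entropy of the channel
`P_{V|U,Y}` with respect to any kernel from `𝒴`. -/
lemma condMutualInfo_le_klDiv {U : Ω → α} {V : Ω → β} {Y : Ω → 𝒴} (hU : Measurable U)
    (hV : Measurable V) (hY : Measurable Y) (μ : Measure Ω) [IsProbabilityMeasure μ]
    (η : Kernel 𝒴 β) [IsMarkovKernel η] :
    condMutualInfo U V Y μ ≤ klDiv (μ.map (fun ω => ((Y ω, U ω), V ω)))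
      (μ.map (fun ω => (Y ω, U ω)) ⊗ₘ η.prodMkRight α) := by
  have : IsProbabilityMeasure (μ.map Y) := Measure.isProbabilityMeasure_map hY.aemeasurable
  have : IsProbabilityMeasure (μ.map (fun ω => (Y ω, U ω))) :=
    Measure.isProbabilityMeasure_map (by fun_prop)
  have : IsProbabilityMeasure (μ.map (fun ω => (Y ω, V ω))) :=
    Measure.isProbabilityMeasure_map (by fun_prop)
  have : IsProbabilityMeasure (μ.map (fun ω => ((Y ω, U ω), V ω))) :=
    Measure.isProbabilityMeasure_map (by fun_prop)
  have hYU : μ.map (fun ω => (Y ω, U ω)) = (μ.map Y) ⊗ₘ condDistrib U Y μ :=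
    (compProd_map_condDistrib hU.aemeasurable).symm
  have hYV : μ.map (fun ω => (Y ω, V ω)) = (μ.map Y) ⊗ₘ condDistrib V Y μ :=
    (compProd_map_condDistrib hV.aemeasurable).symm
  set T : (𝒴 × α) × β → (𝒴 × β) × α := fun p => ((p.1.1, p.2), p.1.2) with hT
  have hTm : Measurable T := by fun_prop
  set S : (𝒴 × β) × α → 𝒴 × α × β := fun p => (p.1.1, p.2, p.1.2) with hS
  have hSm : Measurable S := by fun_prop
  -- A kernel ignoring `U` makes the two outputs conditionally independent given `Y`, so by Tonelli
  -- they may be drawn in either order.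
  have swap : ∀ (η' : Kernel 𝒴 β) [IsMarkovKernel η'],
      ((μ.map (fun ω => (Y ω, U ω))) ⊗ₘ η'.prodMkRight α).map T
        = (μ.map Y ⊗ₘ η') ⊗ₘ (condDistrib U Y μ).prodMkRight β := by
    intro η' _
    rw [hYU]
    refine Measure.ext_of_lintegral _ fun g hg => ?_
    rw [lintegral_map hg hTm, lintegral_compProd_prodMkRight _ _ _ (by fun_prop),
      lintegral_compProd_prodMkRight _ _ _ hg]
    refine lintegral_congr fun y => ?_
    simp only [hT]
    exact lintegral_lintegral_swap (Measurable.aemeasurable (by fun_prop))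
  have hjoint : (μ.map (fun ω => ((Y ω, U ω), V ω))).map T
      = μ.map (fun ω => (Y ω, V ω)) ⊗ₘ condDistrib U (fun ω => (Y ω, V ω)) μ := by
    rw [compProd_map_condDistrib hU.aemeasurable, Measure.map_map hTm (by fun_prop)]
    rfl
  have hS1 : (μ.map (fun ω => (Y ω, V ω)) ⊗ₘ condDistrib U (fun ω => (Y ω, V ω)) μ).map S
      = μ.map (fun ω => (Y ω, (U ω, V ω))) := by
    rw [compProd_map_condDistrib hU.aemeasurable, Measure.map_map hSm (by fun_prop)]
    rfl
  have hS2 : (μ.map (fun ω => (Y ω, V ω)) ⊗ₘ (condDistrib U Y μ).prodMkRight β).map S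
      = (μ.map Y).compProd ((condDistrib U Y μ).prod (condDistrib V Y μ)) := by
    rw [hYV]
    refine Measure.ext_of_lintegral _ fun g hg => ?_
    rw [lintegral_map hg hSm, lintegral_compProd_prodMkRight _ _ _ (by fun_prop),
      Measure.lintegral_compProd hg]
    refine lintegral_congr fun y => ?_
    rw [Kernel.lintegral_prod _ _ _ (by fun_prop)]
    simp only [hS]
    exact lintegral_lintegral_swap (Measurable.aemeasurable (by fun_prop))
  calc condMutualInfo U V Y μ
      ≤ klDiv (μ.map (fun ω => (Y ω, V ω)) ⊗ₘ condDistrib U (fun ω => (Y ω, V ω)) μ)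
          (μ.map (fun ω => (Y ω, V ω)) ⊗ₘ (condDistrib U Y μ).prodMkRight β) := by
        rw [condMutualInfo, ← hS1, ← hS2]
        exact klDiv_map_le _ _ hSm
    -- The discarded term is the divergence of `P_{YV}` from `P_Y ⊗ η`.
    _ ≤ klDiv (μ.map (fun ω => (Y ω, V ω)) ⊗ₘ condDistrib U (fun ω => (Y ω, V ω)) μ)
          ((μ.map Y ⊗ₘ η) ⊗ₘ (condDistrib U Y μ).prodMkRight β) := by
        rw [klDiv_compProd_eq_add (μ.map (fun ω => (Y ω, V ω))) (μ.map Y ⊗ₘ η)]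
        exact le_add_self
    _ ≤ _ := by
        rw [← hjoint, ← swap η]
        exact klDiv_map_le _ _ hTm

end Golden

lemma half_mul_logPos_ofReal {x : ℝ} (hx : 0 < x) :
    1 / 2 * logPos (ENNReal.ofReal x) = ENNReal.ofReal (Real.log x / 2) := by
  rw [logPos, ENNReal.log_ofReal_of_pos hx, EReal.toENNReal_of_ne_top (EReal.coe_ne_top _),
    EReal.toReal_coe, one_div, ← ENNReal.div_eq_inv_mul, ENNReal.ofReal_div_of_pos two_pos]
  simp

/-! ### The upper bound -/

section Upper

variable {Ω 𝒴 : Type*} [MeasurableSpace Ω] [MeasurableSpace 𝒴]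

/-- The output of the test channel `N(f(Y, X), v)` is an admissible `X̂`: independent centred noise
adds `v` to the distortion. -/
lemma condRateDistortion_le_klDiv {μ : Measure Ω} [IsProbabilityMeasure μ]
    {X : Ω → ℝ} {Y : Ω → 𝒴} (hX : Measurable X) (hY : Measurable Y) {Δ : ℝ}
    {f : 𝒴 × ℝ → ℝ} (hf : Measurable f) (v : ℝ≥0)
    (hint : Integrable (fun p => (p.2 - f p) ^ 2) (μ.map (fun ω => (Y ω, X ω))))
    (hle : ∫ p, (p.2 - f p) ^ 2 ∂(μ.map (fun ω => (Y ω, X ω))) + v ≤ Δ)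
    (η : Kernel 𝒴 ℝ) [IsMarkovKernel η] :
    condRateDistortion X Y μ Δ
      ≤ klDiv (μ.map (fun ω => (Y ω, X ω)) ⊗ₘ gaussianChannel f hf v)
          (μ.map (fun ω => (Y ω, X ω)) ⊗ₘ η.prodMkRight ℝ) := by
  set ρ := μ.map (fun ω => (Y ω, X ω)) with hρ
  have : IsProbabilityMeasure ρ := Measure.isProbabilityMeasure_map (by fun_prop)
  set J := ρ ⊗ₘ gaussianChannel f hf v with hJ
  have hJfst : J.map Prod.fst = ρ := Measure.fst_compProd _ _
  set T : (𝒴 × ℝ) × ℝ → (ℝ × 𝒴) × ℝ := fun p => ((p.1.2, p.1.1), p.2) with hT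
  have hTm : Measurable T := by fun_prop
  have hQ : IsProbabilityMeasure (J.map T) := Measure.isProbabilityMeasure_map hTm.aemeasurable
  have hmarg : (J.map T).map Prod.fst = μ.map (fun ω => (X ω, Y ω)) := by
    rw [Measure.map_map measurable_fst hTm,
      show Prod.fst ∘ T = Prod.swap ∘ Prod.fst from rfl,
      ← Measure.map_map measurable_swap measurable_fst, hJfst, hρ,
      Measure.map_map measurable_swap (by fun_prop)]
    rfl
  have hdist : ∫⁻ p, ENNReal.ofReal ((p.1.1 - p.2) ^ 2) ∂(J.map T) ≤ ENNReal.ofReal Δ := by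
    obtain ⟨i, e⟩ := integral_sq_gaussian_noise ρ (u := fun p => f p - p.2) (by fun_prop)
      (by simpa only [sub_sq_comm] using hint) v
    rw [lintegral_map (by fun_prop) hTm, hJ, compProd_gaussianChannel_eq_map,
      lintegral_map (by fun_prop) (by fun_prop)]
    have : ∀ p : (𝒴 × ℝ) × ℝ, (p.1.2 - (f p.1 + p.2)) ^ 2 = (f p.1 - p.1.2 + p.2) ^ 2 :=
      fun p => by ring
    simp only [hT, this]
    rw [← ofReal_integral_eq_lintegral_ofReal i (ae_of_all _ fun p => sq_nonneg _), e]
    refine ENNReal.ofReal_le_ofReal ?_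
    simpa only [sub_sq_comm] using hle
  have hI := condMutualInfo_le_klDiv (U := fun p : (ℝ × 𝒴) × ℝ => p.1.1) (V := fun p => p.2)
    (Y := fun p => p.1.2) (by fun_prop) (by fun_prop) (by fun_prop) (J.map T) η
  rw [Measure.map_map (by fun_prop) hTm, Measure.map_map (by fun_prop) hTm] at hI
  have e1 : J.map ((fun p : (ℝ × 𝒴) × ℝ => ((p.1.2, p.1.1), p.2)) ∘ T) = J := Measure.map_id
  have e2 : J.map ((fun p : (ℝ × 𝒴) × ℝ => (p.1.2, p.1.1)) ∘ T) = ρ := hJfst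
  rw [e1, e2] at hI
  refine le_trans ?_ hI
  unfold condRateDistortion
  exact iInf_le_of_le ⟨J.map T, hQ⟩ (iInf_le_of_le hmarg (iInf_le_of_le hdist le_rfl))

lemma condRateDistortion_le {μ : Measure Ω} [IsProbabilityMeasure μ]
    {X : Ω → ℝ} {Y : Ω → 𝒴} (hX : Measurable X) (hY : Measurable Y) {Δ : ℝ} (hΔ : 0 < Δ) :
    condRateDistortion X Y μ Δ
      ≤ 1 / 2 * logPos (meanCondVar X Y μ / ENNReal.ofReal Δ) := by
  by_cases htop : meanCondVar X Y μ = ∞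
  · rw [htop, ENNReal.top_div_of_ne_top ENNReal.ofReal_ne_top]
    simp [logPos]
  set ρ := μ.map (fun ω => (Y ω, X ω)) with hρ
  have : IsProbabilityMeasure ρ := Measure.isProbabilityMeasure_map (by fun_prop)
  have : IsProbabilityMeasure (μ.map Y) := Measure.isProbabilityMeasure_map hY.aemeasurable
  set m : 𝒴 → ℝ := fun y => ∫ x, x ∂(condDistrib X Y μ y) with hm
  have hmm : Measurable m :=
    (StronglyMeasurable.integral_condDistrib (f := fun p : 𝒴 × ℝ => p.2)
      measurable_snd.stronglyMeasurable).measurable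
  -- Where the conditional law has no mean, `m` takes the default value 0. `evariance` uses the same
  -- convention, so no integrability is needed here.
  have hV : ∫⁻ p, ENNReal.ofReal ((p.2 - m p.1) ^ 2) ∂ρ = meanCondVar X Y μ := by
    rw [hρ, ← compProd_map_condDistrib hX.aemeasurable, Measure.lintegral_compProd (by fun_prop)]
    simp only [meanCondVar, evariance_eq_lintegral_ofReal, hm]
  have hint : Integrable (fun p : 𝒴 × ℝ => (p.2 - m p.1) ^ 2) ρ := by
    refine ⟨by fun_prop, ?_⟩
    rw [hasFiniteIntegral_iff_ofReal (ae_of_all _ fun p => sq_nonneg _), hV]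
    exact lt_top_iff_ne_top.2 htop
  set W : ℝ := ∫ p, (p.2 - m p.1) ^ 2 ∂ρ with hW
  have hW0 : 0 ≤ W := integral_nonneg fun p => sq_nonneg _
  have hVW : meanCondVar X Y μ = ENNReal.ofReal W := by
    rw [← hV, hW, ofReal_integral_eq_lintegral_ofReal hint (ae_of_all _ fun p => sq_nonneg _)]
  rcases le_or_gt W Δ with hle | hlt
  · have h := condRateDistortion_le_klDiv hX hY (Δ := Δ) (f := fun p => m p.1) (by fun_prop) 0
      hint (by simpa using hle) (gaussianChannel m hmm 0)
    have e : (gaussianChannel m hmm 0).prodMkRight ℝ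
        = gaussianChannel (fun p : 𝒴 × ℝ => m p.1) (by fun_prop) 0 := rfl
    rw [e, klDiv_self] at h
    exact h.trans zero_le
  · have hWpos : 0 < W := hΔ.trans hlt
    -- With this `a`, the distortion is `(1 - a)² W + Δa = (1 - a)Δ + Δa = Δ`.
    set a : ℝ := 1 - Δ / W with ha
    have ha0 : 0 < a := by rw [ha, sub_pos, div_lt_one hWpos]; exact hlt
    have hΔW : Δ = (1 - a) * W := by rw [ha]; field_simp; ring
    have hsq1 : ∀ p : 𝒴 × ℝ, (p.2 - (m p.1 + a * (p.2 - m p.1))) ^ 2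
        = (1 - a) ^ 2 * (p.2 - m p.1) ^ 2 := fun p => by ring
    have hsq2 : ∀ p : 𝒴 × ℝ, (m p.1 + a * (p.2 - m p.1) - m p.1) ^ 2
        = a ^ 2 * (p.2 - m p.1) ^ 2 := fun p => by ring
    have h := condRateDistortion_le_klDiv hX hY (Δ := Δ)
      (f := fun p => m p.1 + a * (p.2 - m p.1)) (by fun_prop) (Δ * a).toNNReal
      (by simp only [hsq1]; exact hint.const_mul _)
      (by
        simp only [hsq1]
        rw [integral_const_mul, Real.coe_toNNReal _ (by positivity), ← hW, hΔW]
        exact le_of_eq (by ring))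
      (gaussianChannel m hmm (W * a).toNNReal)
    have e : (gaussianChannel m hmm (W * a).toNNReal).prodMkRight ℝ
        = gaussianChannel (fun p : 𝒴 × ℝ => m p.1) (by fun_prop) (W * a).toNNReal := rfl
    rw [e, klDiv_gaussianChannel _ _ _ (by simp; positivity) (by simp; positivity)
      (by simp only [hsq2]; exact hint.const_mul _)] at h
    simp only [hsq2] at h
    rw [integral_const_mul, Real.coe_toNNReal _ (by positivity),
      Real.coe_toNNReal _ (by positivity), ← hW, mul_div_mul_right _ _ ha0.ne'] at h
    rw [hVW, ← ENNReal.ofReal_div_of_pos hΔ, half_mul_logPos_ofReal (by positivity)]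
    refine h.trans (le_of_eq ?_)
    congr 1
    -- The output has mean square `Wa` around `m(Y)`, exactly the reference variance, so the terms
    -- `± 1/2` cancel.
    have : (a ^ 2 * W + Δ * a) / (2 * (W * a)) = 1 / 2 := by
      rw [hΔW]; field_simp; ring
    rw [this]; ring

end Upper

/-! ### The lower bound -/

section Lower

variable {Ω 𝒴 : Type*} [MeasurableSpace Ω] [MeasurableSpace 𝒴]

/-- The candidate laws `Q` live on another space, so the entropy must be seen to depend only on the
law of `(Y, X)`. -/
lemma condDiffEntropy_eq_lintegral_map {X : Ω → ℝ} {Y : Ω → 𝒴} (hX : Measurable X)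
    (hY : Measurable Y) (μ : Measure Ω) :
    condDiffEntropy X Y μ = condDiffEntropy Prod.snd Prod.fst (μ.map (fun ω => (Y ω, X ω))) := by
  have h1 : (μ.map (fun ω => (Y ω, X ω))).map Prod.fst = μ.map Y :=
    Measure.map_map measurable_fst (by fun_prop)
  have h2 : (μ.map (fun ω => (Y ω, X ω))).map (fun p => (p.1, p.2))
      = μ.map (fun ω => (Y ω, X ω)) := Measure.map_id
  have hd : Measurable (condDensity X Y μ) := (Measure.measurable_rnDeriv _ _).ennreal_toReal
  have hd' : condDensity Prod.snd Prod.fst (μ.map (fun ω => (Y ω, X ω))) = condDensity X Y μ := by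
    ext p; rw [condDensity, condDensity, h1, h2]
  by_cases hac : μ.map (fun ω => (Y ω, X ω)) ≪ (μ.map Y).prod volume
  · rw [condDiffEntropy, condDiffEntropy, if_pos hac, if_pos (by rwa [h1, h2]), hd',
      lintegral_map (by fun_prop) (by fun_prop), lintegral_map (by fun_prop) (by fun_prop)]
  · rw [condDiffEntropy, condDiffEntropy, if_neg hac, if_neg (by rwa [h1, h2])]

lemma condEntropyPower_congr {Ω' : Type*} [MeasurableSpace Ω'] {X : Ω → ℝ} {Y : Ω → 𝒴}
    (hX : Measurable X) (hY : Measurable Y) {X' : Ω' → ℝ} {Y' : Ω' → 𝒴} (hX' : Measurable X')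
    (hY' : Measurable Y') {μ : Measure Ω} {μ' : Measure Ω'}
    (h : μ.map (fun ω => (Y ω, X ω)) = μ'.map (fun ω => (Y' ω, X' ω))) :
    condEntropyPower X Y μ = condEntropyPower X' Y' μ' := by
  rw [condEntropyPower, condEntropyPower, condDiffEntropy_eq_lintegral_map hX hY,
    condDiffEntropy_eq_lintegral_map hX' hY', h]

/-- Integrating a family `g · t` of subprobability densities divided by the conditional density
of `U` against `P_Y ⊗ (P_{U|Y} × P_{V|Y})` gives at most `1`. -/
lemma lintegral_div_condDensity_le {U V : Ω → ℝ} {Y : Ω → 𝒴} (hU : Measurable U)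
    (hY : Measurable Y) {μ : Measure Ω} [IsProbabilityMeasure μ] {g : ℝ × ℝ → ℝ≥0∞}
    (hg : Measurable g) (hg1 : ∀ t, ∫⁻ x, g (x, t) ≤ 1)
    (hac : μ.map (fun ω => (Y ω, U ω)) ≪ (μ.map Y).prod volume) :
    ∫⁻ p, g p.2 / (μ.map (fun ω => (Y ω, U ω))).rnDeriv ((μ.map Y).prod volume) (p.1, p.2.1)
      ∂((μ.map Y).compProd ((condDistrib U Y μ).prod (condDistrib V Y μ))) ≤ 1 := by
  have : IsProbabilityMeasure (μ.map Y) := Measure.isProbabilityMeasure_map hY.aemeasurable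
  have : IsProbabilityMeasure (μ.map (fun ω => (Y ω, U ω))) :=
    Measure.isProbabilityMeasure_map (by fun_prop)
  set r := (μ.map (fun ω => (Y ω, U ω))).rnDeriv ((μ.map Y).prod volume) with hr
  have hrm : Measurable r := Measure.measurable_rnDeriv _ _
  set G : 𝒴 × ℝ → ℝ≥0∞ := fun q => ∫⁻ t, g (q.2, t) ∂(condDistrib V Y μ q.1) with hG
  have hGm : Measurable G :=
    Measurable.lintegral_kernel_prod_right' (κ := (condDistrib V Y μ).prodMkRight ℝ)
      (f := fun p : (𝒴 × ℝ) × ℝ => g (p.1.2, p.2)) (by fun_prop)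
  have hD : Measurable (fun p : 𝒴 × ℝ × ℝ => g p.2 / r (p.1, p.2.1)) := by fun_prop
  have hGr : Measurable (fun q => G q / r q) := by fun_prop
  calc ∫⁻ p, g p.2 / r (p.1, p.2.1)
        ∂((μ.map Y).compProd ((condDistrib U Y μ).prod (condDistrib V Y μ)))
      = ∫⁻ y, ∫⁻ x, G (y, x) / r (y, x) ∂(condDistrib U Y μ y) ∂(μ.map Y) := by
        rw [Measure.lintegral_compProd hD]
        refine lintegral_congr fun y => ?_
        rw [Kernel.lintegral_prod _ _ _ (by fun_prop)]
        refine lintegral_congr fun x => ?_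
        simp only [div_eq_mul_inv, hG]
        exact lintegral_mul_const _ (by fun_prop)
    _ = ∫⁻ q, G q / r q ∂(μ.map (fun ω => (Y ω, U ω))) := by
        rw [← Measure.lintegral_compProd hGr, compProd_map_condDistrib hU.aemeasurable]
    -- The change of measure brings in the factor `r` cancelling the denominator; only `≤` follows,
    -- since `r` may be 0 or `∞`.
    _ = ∫⁻ q, r q * (G q / r q) ∂((μ.map Y).prod volume) :=
        (lintegral_rnDeriv_mul hac hGr.aemeasurable).symm
    _ ≤ ∫⁻ q, G q ∂((μ.map Y).prod volume) := lintegral_mono fun q => ENNReal.mul_div_le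
    _ = ∫⁻ y, ∫⁻ t, (∫⁻ x, g (x, t)) ∂(condDistrib V Y μ y) ∂(μ.map Y) := by
        rw [lintegral_prod _ hGm.aemeasurable]
        refine lintegral_congr fun y => ?_
        exact lintegral_lintegral_swap (μ := volume) (ν := condDistrib V Y μ y)
          (f := fun x t => g (x, t)) hg.aemeasurable
    _ ≤ ∫⁻ y, ∫⁻ t, 1 ∂(condDistrib V Y μ y) ∂(μ.map Y) :=
        lintegral_mono fun y => lintegral_mono fun t => hg1 t
    _ = 1 := by simp

lemma logPos_condEntropyPower_le_condMutualInfo {U V : Ω → ℝ} {Y : Ω → 𝒴} (hU : Measurable U)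
    (hV : Measurable V) (hY : Measurable Y) {μ : Measure Ω} [IsProbabilityMeasure μ] {Δ : ℝ}
    (hΔ : 0 < Δ) (hdist : ∫⁻ ω, ENNReal.ofReal ((U ω - V ω) ^ 2) ∂μ ≤ ENNReal.ofReal Δ) :
    1 / 2 * logPos (condEntropyPower U Y μ / ENNReal.ofReal Δ) ≤ condMutualInfo U V Y μ := by
  by_cases hI : condMutualInfo U V Y μ = ∞
  · rw [hI]; exact le_top
  by_cases hh : condDiffEntropy U Y μ = ⊥
  · have : condEntropyPower U Y μ = 0 := by
      rw [condEntropyPower, hh, EReal.mul_bot_of_pos (by norm_num)]; simp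
    rw [this]; simp [logPos]
  have hac : μ.map (fun ω => (Y ω, U ω)) ≪ (μ.map Y).prod volume := by
    by_contra hac; exact hh (if_neg hac)
  have : IsProbabilityMeasure (μ.map Y) := Measure.isProbabilityMeasure_map hY.aemeasurable
  have : IsProbabilityMeasure (μ.map (fun ω => (Y ω, U ω))) :=
    Measure.isProbabilityMeasure_map (by fun_prop)
  have hYUV : Measurable (fun ω => (Y ω, (U ω, V ω))) := by fun_prop
  set J := μ.map (fun ω => (Y ω, (U ω, V ω))) with hJ
  have : IsProbabilityMeasure J := Measure.isProbabilityMeasure_map hYUV.aemeasurable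
  set ν := (μ.map Y).compProd ((condDistrib U Y μ).prod (condDistrib V Y μ)) with hR
  have : IsProbabilityMeasure ν := by
    have : IsMarkovKernel ((condDistrib U Y μ).prod (condDistrib V Y μ)) :=
      inferInstanceAs (IsMarkovKernel (condDistrib U Y μ ×ₖ condDistrib V Y μ))
    rw [hR]; infer_instance
  obtain ⟨hJR, hllr⟩ : J ≪ ν ∧ Integrable (llr J ν) J := klDiv_ne_top_iff.1 hI
  have hIeq : condMutualInfo U V Y μ = ENNReal.ofReal (∫ p, llr J ν p ∂J) := by
    change klDiv J ν = _
    rw [klDiv_of_ac_of_integrable hJR hllr]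
    simp
  set v : ℝ≥0 := Δ.toNNReal with hv
  have hv0 : v ≠ 0 := by simpa [hv] using hΔ
  have hvΔ : (v : ℝ) = Δ := Real.coe_toNNReal _ hΔ.le
  set r := (μ.map (fun ω => (Y ω, U ω))).rnDeriv ((μ.map Y).prod volume) with hr
  have hrm : Measurable r := Measure.measurable_rnDeriv _ _
  have hg : Measurable (fun q : ℝ × ℝ => gaussianPDF q.2 v q.1) :=
    measurable_uncurry_gaussianPDF.comp (by fun_prop : Measurable fun p : ℝ × ℝ => (p.2, v, p.1))
  -- the likelihood ratio of the Gaussian backward channel and the true one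
  set D : 𝒴 × ℝ × ℝ → ℝ≥0∞ := fun p => gaussianPDF p.2.2 v p.2.1 / r (p.1, p.2.1) with hD
  have hDm : Measurable D := (hg.comp measurable_snd).div (hrm.comp (by fun_prop))
  have hrnm : Measurable (J.rnDeriv ν) := Measure.measurable_rnDeriv _ _
  set T : 𝒴 × ℝ × ℝ → ℝ≥0∞ := fun p => D p / J.rnDeriv ν p with hT
  have hTm : Measurable T := hDm.div hrnm
  have hTle : ∫⁻ p, T p ∂J ≤ 1 :=
    calc ∫⁻ p, T p ∂J = ∫⁻ p, J.rnDeriv ν p * T p ∂ν :=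
          (lintegral_rnDeriv_mul hJR hTm.aemeasurable).symm
      _ ≤ ∫⁻ p, D p ∂ν := lintegral_mono fun p => ENNReal.mul_div_le
      _ ≤ 1 := lintegral_div_condDensity_le hU hY hg
          (fun t => (lintegral_gaussianPDF_eq_one t hv0).le) hac
  have hmarg : J.map (fun p => (p.1, p.2.1)) = μ.map (fun ω => (Y ω, U ω)) := by
    rw [hJ, Measure.map_map (by fun_prop) hYUV]; rfl
  have hrpos : ∀ᵐ p ∂J, 0 < r (p.1, p.2.1) := by
    have h : ∀ᵐ q ∂(J.map (fun p => (p.1, p.2.1))), 0 < r q := by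
      rw [hmarg]; exact Measure.rnDeriv_pos hac
    exact ae_of_ae_map (f := fun p : 𝒴 × ℝ × ℝ => (p.1, p.2.1)) (by fun_prop) h
  have hrfin : ∀ᵐ p ∂J, r (p.1, p.2.1) ≠ ∞ := by
    have h : ∀ᵐ q ∂(J.map (fun p => (p.1, p.2.1))), r q ≠ ∞ := by
      rw [hmarg]; exact hac.ae_le (Measure.rnDeriv_ne_top _ _)
    exact ae_of_ae_map (f := fun p : 𝒴 × ℝ × ℝ => (p.1, p.2.1)) (by fun_prop) h
  set b : 𝒴 × ℝ × ℝ → ℝ := fun p => -(Real.log (2 * Real.pi * Δ) / 2)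
    - (p.2.1 - p.2.2) ^ 2 / (2 * Δ) with hb
  set c : 𝒴 × ℝ × ℝ → ℝ := fun p => -Real.log (r (p.1, p.2.1)).toReal with hc
  have hcm : Measurable c := (Real.measurable_log.comp
    (hrm.comp (by fun_prop : Measurable fun p : 𝒴 × ℝ × ℝ => (p.1, p.2.1))).ennreal_toReal).neg
  -- This is `log T ≤ T - 1`, where `b + c` is the logarithm of `D`.
  have hlog : ∀ᵐ p ∂J, b p + c p - llr J ν p ≤ (T p).toReal - 1 := by
    filter_upwards [hrpos, hrfin, Measure.rnDeriv_pos hJR,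
      hJR.ae_le (Measure.rnDeriv_ne_top J ν)] with p h1 h2 h3 h4
    have k1 : 0 < (gaussianPDF p.2.2 v p.2.1).toReal := by
      rw [toReal_gaussianPDF]; exact gaussianPDFReal_pos _ _ _ hv0
    have k2 := ENNReal.toReal_pos h1.ne' h2
    have k3 := ENNReal.toReal_pos h3.ne' h4
    have k : (T p).toReal = (gaussianPDF p.2.2 v p.2.1).toReal / (r (p.1, p.2.1)).toReal
        / (J.rnDeriv ν p).toReal := by simp only [hT, hD, ENNReal.toReal_div]
    have := Real.log_le_sub_one_of_pos (x := (T p).toReal) (by rw [k]; positivity)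
    refine le_trans (le_of_eq ?_) this
    rw [k, Real.log_div (by positivity) (by positivity), Real.log_div (by positivity)
      (by positivity), log_gaussianPDF _ hv0, hvΔ]
    simp only [hb, hc, llr]
    ring
  -- integrability
  have hdJ : ∫⁻ p, ENNReal.ofReal ((p.2.1 - p.2.2) ^ 2) ∂J ≤ ENNReal.ofReal Δ := by
    rw [hJ, lintegral_map (by fun_prop) hYUV]; exact hdist
  have hdint : Integrable (fun p : 𝒴 × ℝ × ℝ => (p.2.1 - p.2.2) ^ 2) J := by
    refine ⟨by fun_prop, ?_⟩
    rw [hasFiniteIntegral_iff_ofReal (ae_of_all _ fun p => sq_nonneg _)]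
    exact hdJ.trans_lt ENNReal.ofReal_lt_top
  have hdle : ∫ p, (p.2.1 - p.2.2) ^ 2 ∂J ≤ Δ := by
    rw [← ENNReal.ofReal_le_ofReal_iff hΔ.le, ofReal_integral_eq_lintegral_ofReal hdint
      (ae_of_all _ fun p => sq_nonneg _)]
    exact hdJ
  have hbint : Integrable b J := (integrable_const _).sub (hdint.div_const _)
  have hTint : Integrable (fun p => (T p).toReal) J :=
    integrable_toReal_of_lintegral_ne_top hTm.aemeasurable (hTle.trans_lt ENNReal.one_lt_top).ne
  have hTint1 : ∫ p, (T p).toReal ∂J ≤ 1 := by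
    rw [integral_toReal hTm.aemeasurable
      (ae_lt_top hTm (hTle.trans_lt ENNReal.one_lt_top).ne)]
    exact ENNReal.toReal_le_of_le_ofReal zero_le_one (by simpa using hTle)
  have hpos : ∫⁻ ω, ENNReal.ofReal (-Real.log (condDensity U Y μ (Y ω, U ω))) ∂μ
      = ∫⁻ p, ENNReal.ofReal (c p) ∂J := by
    rw [hJ, lintegral_map (by fun_prop) hYUV]; rfl
  have hneg : ∫⁻ ω, ENNReal.ofReal (Real.log (condDensity U Y μ (Y ω, U ω))) ∂μ
      = ∫⁻ p, ENNReal.ofReal (-c p) ∂J := by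
    rw [hJ, lintegral_map (by fun_prop) hYUV]; simp only [hc, neg_neg]; rfl
  have hent : condDiffEntropy U Y μ = ((∫⁻ p, ENNReal.ofReal (c p) ∂J : ℝ≥0∞) : EReal)
      - ((∫⁻ p, ENNReal.ofReal (-c p) ∂J : ℝ≥0∞) : EReal) := by
    rw [condDiffEntropy, if_pos hac, hpos, hneg]
  -- In `EReal`, subtracting `⊤` gives `⊥` even from `⊤`, which is excluded by `hh`.
  have hnegfin : ∫⁻ p, ENNReal.ofReal (-c p) ∂J ≠ ∞ := by
    intro h; rw [h] at hent; exact hh (by simpa using hent)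
  -- The negative part is finite because `h ≠ ⊥`; the upper bound comes from `hlog` and the
  -- finiteness of the mutual information.
  have hcint : Integrable c J := by
    refine integrable_of_le_of_le (g₁ := fun p => -(ENNReal.ofReal (-c p)).toReal)
      (g₂ := fun p => (T p).toReal - 1 + llr J ν p - b p) hcm.aestronglyMeasurable
      (ae_of_all _ fun p => ?_) ?_ ?_ ?_
    · simp only [ENNReal.toReal_ofReal']
      linarith [le_max_left (-c p) 0]
    · filter_upwards [hlog] with p hp
      linarith
    · exact (integrable_toReal_of_lintegral_ne_top (by fun_prop) hnegfin).neg
    · exact ((hTint.sub (integrable_const _)).add hllr).sub hbint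
  have hposfin : ∫⁻ p, ENNReal.ofReal (c p) ∂J ≠ ∞ := hcint.lintegral_lt_top.ne
  have hent' : condDiffEntropy U Y μ = ((∫ p, c p ∂J : ℝ) : EReal) := by
    rw [hent, integral_eq_lintegral_pos_part_sub_lintegral_neg_part hcint, EReal.coe_sub,
      EReal.coe_ennreal_toReal hposfin, EReal.coe_ennreal_toReal hnegfin]
  set h := ∫ p, c p ∂J with hhdef
  have hmain : h - Real.log (2 * Real.pi * Δ) / 2 - 1 / 2 ≤ ∫ p, llr J ν p ∂J := by
    have h1 : ∫ p, (b p + c p - llr J ν p) ∂J ≤ ∫ p, ((T p).toReal - 1) ∂J :=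
      integral_mono_ae ((hbint.add hcint).sub hllr) (hTint.sub (integrable_const _)) hlog
    have hbc : Integrable (fun p => b p + c p) J := hbint.add hcint
    rw [integral_sub hbc hllr, integral_add hbint hcint,
      integral_sub hTint (integrable_const _)] at h1
    have h2 : ∫ p, b p ∂J = -(Real.log (2 * Real.pi * Δ) / 2)
        - (∫ p, (p.2.1 - p.2.2) ^ 2 ∂J) / (2 * Δ) := by
      rw [hb, integral_sub (integrable_const _) (hdint.div_const _), integral_div]
      simp
    have h3 : (∫ p, (p.2.1 - p.2.2) ^ 2 ∂J) / (2 * Δ) ≤ 1 / 2 := by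
      rw [div_le_div_iff₀ (by positivity) (by positivity)]; linarith
    simp only [integral_const, probReal_univ, one_smul] at h1
    linarith
  have hN : condEntropyPower U Y μ / ENNReal.ofReal Δ
      = ENNReal.ofReal (1 / (2 * Real.pi * Real.exp 1) * Real.exp (2 * h) / Δ) := by
    rw [condEntropyPower, hent', show (2 : EReal) * ((h : ℝ) : EReal) = ((2 * h : ℝ) : EReal) by
      push_cast; rfl, EReal.exp_coe, ← ENNReal.ofReal_mul (by positivity),
      ← ENNReal.ofReal_div_of_pos hΔ]
  rw [hN, half_mul_logPos_ofReal (by positivity), hIeq]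
  refine ENNReal.ofReal_le_ofReal (le_trans (le_of_eq ?_) hmain)
  rw [Real.log_div (by positivity) hΔ.ne', Real.log_mul (by positivity) (by positivity),
    Real.log_exp, one_div, Real.log_inv, Real.log_mul (by positivity) (by positivity),
    Real.log_exp, Real.log_mul (y := Δ) (by positivity) (by positivity)]
  ring

end Lower

end CondRD

end

theorem lemma1 {Ω 𝒴 : Type*} [MeasurableSpace Ω] [MeasurableSpace 𝒴]
    (μ : Measure Ω) [IsProbabilityMeasure μ]
    (X : Ω → ℝ) (Y : Ω → 𝒴) (hX : Measurable X) (hY : Measurable Y)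
    (Δ : ℝ) (hΔ : 0 < Δ) :
    1 / 2 * CondRD.logPos (CondRD.condEntropyPower X Y μ / ENNReal.ofReal Δ)
        ≤ CondRD.condRateDistortion X Y μ Δ ∧
      CondRD.condRateDistortion X Y μ Δ
        ≤ 1 / 2 * CondRD.logPos (CondRD.meanCondVar X Y μ / ENNReal.ofReal Δ) := by
  refine ⟨le_iInf fun Q => le_iInf fun hQ => le_iInf fun hdist => ?_,
    CondRD.condRateDistortion_le hX hY hΔ⟩
  have hlaw : μ.map (fun ω => (Y ω, X ω))
      = (Q : Measure ((ℝ × 𝒴) × ℝ)).map (fun p => (p.1.2, p.1.1)) := by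
    have := congrArg (Measure.map Prod.swap) hQ
    rw [Measure.map_map measurable_swap (by fun_prop),
      Measure.map_map measurable_swap (by fun_prop)] at this
    exact this.symm
  rw [CondRD.condEntropyPower_congr hX hY (X' := fun p : (ℝ × 𝒴) × ℝ => p.1.1)
    (Y' := fun p => p.1.2) (by fun_prop) (by fun_prop) hlaw]
  exact CondRD.logPos_condEntropyPower_le_condMutualInfo (by fun_prop) (by fun_prop)
    (by fun_prop) hΔ hdist
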